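/- Let $\mathcal H$ and $\mathcal G$ be real Hilbert spaces. Let $\Gamma_0(\mathcal H)$ be the class of lower semicontinuous convex functions $f\colon\mathcal H\to\,]-\infty,+\infty]$ with $\operatorname{dom} f=\{x\in\mathcal H : f(x)<+\infty\}\neq\varnothing$, and define $\Gamma_0(\mathcal G)$ likewise. For $f\in\Gamma_0(\mathcal H)$ let $f^*\colon u\mapsto\sup_{x\in\mathcal H}(\langle x, u\rangle-f(x))$ be its conjugate. The subdifferential of a function $h$ from a real Hilbert space to $[-\infty,+\infty]$ is the set-valued operator $\partial h\colon x\mapsto\{u : \langle y-x, u\rangle+h(x)\le h(y)\text{ for all }y\}$. For a bounded linear operator $L\colon\mathcal H\to\mathcal G$ with adjoint $L^*$ and range of the adjoint $\operatorname{ran}L^*$, the infimal postcomposition of $f$ by $L$ is $$L\triangleright f\colon\mathcal G\to[-\infty,+\infty]\colon y\mapsto\inf_{x\in\mathcal H,\ Lx=y}f(x)\qquad(\inf\varnothing=+\infty),$$ and the parallel composition of a set-valued operator $A\colon\mathcal H\to2^{\mathcal H}$ by $L$ is $L\triangleright A=(L\circ A^{-1}\circ L^*)^{-1}\colon\mathcal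 G\to 2^{\mathcal G}$, where the inverse of a set-valued operator $B$ is given by $x\in B^{-1}u\Leftrightarrow u\in Bx$. The strong relative interior $\operatorname{sri}C$ of a convex set $C\subset\mathcal H$ is the set of points $x\in C$ such that the cone $\{t(c-x) : t>0,\ c\in C\}$ generated by $-x+C$ is a closed vector subspace of $\mathcal H$. Let $f\in\Gamma_0(\mathcal H)$ and let $L\colon\mathcal H\to\mathcal G$ be a bounded linear operator such that $$0\in\operatorname{sri}(\operatorname{ran}L^*-\operatorname{dom}f^*),$$ where $\operatorname{ran}L^*-\operatorname{dom}f^*=\{a-b : a\in\operatorname{ran}L^*,\ b\in\operatorname{dom}f^*\}$. Then the following hold. (i) $L\triangleright f\in\Gamma_0(\mathcal G)$. (ii) $\partial(L\triangleright f)=L\triangleright\partial f$. -/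

import Mathlib

open scoped Pointwise

noncomputable section

namespace ParallelComposition

section Functions

variable {H : Type*} {G : Type*}

/-- The effective domain of an extended-real-valued function. -/
def dom (f : H → EReal) : Set H := {x | f x < ⊤}

/-- The infimal postcomposition: its value at `y` is the infimum of `f` over the fibre of `L`
above `y` (the infimum of the empty set being `+∞`). -/
def infPostcomp (L : H → G) (f : H → EReal) : G → EReal :=
  fun y => sInf (f '' (L ⁻¹' {y}))

/-- The inverse of a set-valued operator. -/
def opInv (A : H → Set G) : G → Set H := fun u => {x | u ∈ A x}

end Functions

variable {H : Type*} [NormedAddCommGroup H] [InnerProductSpace ℝ H]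

/-- The class of proper lower semicontinuous convex functions with values in `]-∞, +∞]`.
Convexity is convexity of the epigraph. -/
def Gamma0 (H : Type*) [NormedAddCommGroup H] [InnerProductSpace ℝ H] : Set (H → EReal) :=
  {f | (∀ x, f x ≠ ⊥) ∧ (dom f).Nonempty ∧ LowerSemicontinuous f ∧
    Convex ℝ {p : H × ℝ | f p.1 ≤ (p.2 : EReal)}}

/-- The Fenchel conjugate. -/
def conj (f : H → EReal) : H → EReal :=
  fun u => ⨆ x : H, (((inner ℝ x u : ℝ) : EReal) - f x)

/-- The subdifferential, as a set-valued operator. -/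
def subdiff (f : H → EReal) : H → Set H :=
  fun x => {u | ∀ y : H, ((inner ℝ (y - x) u : ℝ) : EReal) + f x ≤ f y}

/-- The cone generated by a set, that is, the smallest set which contains it and is stable under
multiplication by strictly positive scalars. -/
def coneGen (C : Set H) : Set H := {z | ∃ t : ℝ, 0 < t ∧ ∃ c ∈ C, z = t • c}

/-- The strong relative interior of a set: its points `x` for which the cone generated by `-x + C`
is a closed vector subspace. -/
def sri (C : Set H) : Set H :=
  {x | x ∈ C ∧ ∃ V : Submodule ℝ H,
    IsClosed (V : Set H) ∧ coneGen ((fun c => -x + c) '' C) = (V : Set H)}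

variable {G : Type*} [NormedAddCommGroup G] [InnerProductSpace ℝ G]

/-- The parallel composition of `A` by `L`: the inverse of the set-valued operator which sends `v`
to the image under `L` of the set `A⁻¹ (L* v)`. -/
def parComp [CompleteSpace H] [CompleteSpace G] (L : H →L[ℝ] G) (A : H → Set H) : G → Set G :=
  opInv fun v => L '' opInv A (ContinuousLinearMap.adjoint L v)

end ParallelComposition

end

open scoped Pointwise

noncomputable section

namespace ParallelComposition

/-! Everything follows from exact duality: `L ▷ f` is the conjugate of `f* ∘ L*`, and the infimum is
attained. Then `L ▷ f` is a supremum of continuous affine functions, and a minimiser on a fibre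
transfers subgradients between `f` and `L ▷ f`. The hard half (`exists_map_eq_le_coe`) minimises
`f*(u) - ⟨y, v⟩ + s`, nonnegative on the kernel of `(u, v) ↦ L*v - u`. Baire's theorem on the closed
subspace from the `sri` condition bounds the value function above near 0, so Hahn–Banach gives a
multiplier `x`; then `L(-x) = y`, and Fenchel–Moreau gives `f(-x) ≤ s`. -/

/-- A decreasing sequence of nonempty closed convex subsets of a bounded set in a Hilbert space has
a common point. -/
theorem exists_mem_forall_of_antitone_convex {K : Type*} [NormedAddCommGroup K]
    [InnerProductSpace ℝ K] [CompleteSpace K] {C : ℕ → Set K} (hanti : Antitone C)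
    (hne : ∀ n, (C n).Nonempty) (hcl : ∀ n, IsClosed (C n)) (hconv : ∀ n, Convex ℝ (C n))
    {R : ℝ} (hR : ∀ x ∈ C 0, ‖x‖ ≤ R) : ∃ x, ∀ n, x ∈ C n := by
  -- The points of least norm form a Cauchy sequence: this variational inequality bounds squared
  -- distances by gaps between squared norms, which increase and are bounded.
  have hproj : ∀ n, ∃ a ∈ C n, ∀ w ∈ C n, ‖a‖ ^ 2 ≤ inner ℝ a w := by
    intro n
    obtain ⟨a, ha, hmin⟩ :=
      exists_norm_eq_iInf_of_complete_convex (hne n) (hcl n).isComplete (hconv n) 0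
    refine ⟨a, ha, fun w hw => ?_⟩
    have h := (norm_eq_iInf_iff_real_inner_le_zero (hconv n) ha).1 hmin w hw
    rw [zero_sub, inner_neg_left, inner_sub_right, real_inner_self_eq_norm_sq] at h
    linarith
  choose a ha hinner using hproj
  have hdist : ∀ n m, n ≤ m → ‖a n - a m‖ ^ 2 ≤ ‖a m‖ ^ 2 - ‖a n‖ ^ 2 := by
    intro n m hnm
    have h := hinner n (a m) (hanti hnm (ha m))
    rw [norm_sub_sq_real]
    linarith
  have hmono : Monotone fun n => ‖a n‖ ^ 2 := fun n m hnm => by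
    have := hdist n m hnm
    have := sq_nonneg ‖a n - a m‖
    dsimp only
    linarith
  have hbdd : BddAbove (Set.range fun n => ‖a n‖ ^ 2) := by
    refine ⟨R ^ 2, ?_⟩
    rintro _ ⟨n, rfl⟩
    exact pow_le_pow_left₀ (norm_nonneg _) (hR _ (hanti (Nat.zero_le n) (ha n))) 2
  set c := ⨆ n, ‖a n‖ ^ 2
  have hlim : Filter.Tendsto (fun n => √(c - ‖a n‖ ^ 2)) Filter.atTop (nhds 0) := by
    have h := ((tendsto_atTop_ciSup hmono hbdd).const_sub c).sqrt
    simpa [c] using h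
  have hcauchy : CauchySeq a := by
    refine cauchySeq_of_le_tendsto_0' _ (fun n m hnm => ?_) hlim
    rw [dist_eq_norm]
    refine Real.le_sqrt_of_sq_le ((hdist n m hnm).trans ?_)
    have : ‖a m‖ ^ 2 ≤ c := le_ciSup hbdd m
    linarith
  obtain ⟨x, hx⟩ := cauchySeq_tendsto_of_complete hcauchy
  refine ⟨x, fun n => (hcl n).mem_of_tendsto hx ?_⟩
  filter_upwards [Filter.eventually_ge_atTop n] with m hm using hanti hm (ha m)

/-- The image of a bounded closed convex subset of a Hilbert space under a bounded linear operator
is closed. -/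
theorem isClosed_image_of_convex_of_bounded {K H : Type*} [NormedAddCommGroup K]
    [InnerProductSpace ℝ K] [CompleteSpace K] [NormedAddCommGroup H] [NormedSpace ℝ H]
    (T : K →L[ℝ] H) {S : Set K} (hcl : IsClosed S) (hconv : Convex ℝ S) {R : ℝ}
    (hR : ∀ x ∈ S, ‖x‖ ≤ R) : IsClosed (T '' S) := by
  refine isClosed_of_closure_subset fun w hw => ?_
  obtain ⟨x, hx⟩ := exists_mem_forall_of_antitone_convex
    (C := fun n : ℕ => S ∩ T ⁻¹' Metric.closedBall w (1 / (n + 1))) (R := R)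
    (fun n m hnm => Set.inter_subset_inter_right _ (Set.preimage_mono
      (Metric.closedBall_subset_closedBall (Nat.one_div_le_one_div hnm))))
    (fun n => by
      obtain ⟨_, ⟨k, hk, rfl⟩, hd⟩ := Metric.mem_closure_iff.1 hw _ (Nat.one_div_pos_of_nat (n := n))
      exact ⟨k, hk, by rw [Set.mem_preimage, Metric.mem_closedBall, dist_comm]; exact hd.le⟩)
    (fun n => hcl.inter (Metric.isClosed_closedBall.preimage T.continuous))
    (fun n => hconv.inter ((convex_closedBall _ _).linear_preimage T.toLinearMap))
    (fun x hx => hR x hx.1)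
  refine ⟨x, (hx 0).1, ?_⟩
  have h : dist (T x) w ≤ 0 :=
    ge_of_tendsto' tendsto_one_div_add_atTop_nhds_zero_nat fun n => (hx n).2
  exact dist_le_zero.1 h

/-! ### Baire and Hahn–Banach under the qualification condition -/

/-- If the cone generated by the image under `T` of the domain of a closed convex set `E ⊆ K × ℝ`
(an epigraph) is a closed subspace, then bounded points of the domain cover a ball of it. -/
theorem exists_forall_norm_lt_exists_map_eq {K H : Type*} [NormedAddCommGroup K]
    [InnerProductSpace ℝ K] [CompleteSpace K] [NormedAddCommGroup H] [NormedSpace ℝ H]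
    [CompleteSpace H] (T : K →L[ℝ] H) {E : Set (K × ℝ)} (hconv : Convex ℝ E) (hcl : IsClosed E)
    (hup : ∀ k r r', (k, r) ∈ E → r ≤ r' → (k, r') ∈ E) {V : Submodule ℝ H}
    (hV : IsClosed (V : Set H))
    (hcone : ∀ z ∈ V, ∃ t : ℝ, 0 < t ∧ ∃ k r, (k, r) ∈ E ∧ z = t • T k) :
    ∃ δ > 0, ∃ N : ℝ, ∀ z ∈ V, ‖z‖ < δ → ∃ k, (k, N) ∈ E ∧ T k = z := by
  -- Truncating both norm and height makes the images under `T` closed, as Baire's theorem requires.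
  set S : ℕ → Set K := fun n => Metric.closedBall 0 n ∩ {k | (k, (n : ℝ)) ∈ E}
  have hSconv : ∀ n, Convex ℝ (S n) := by
    refine fun n => (convex_closedBall _ _).inter fun k hk l hl a b ha hb hab => ?_
    have h := hconv hk hl ha hb hab
    simp only [Prod.smul_mk, Prod.mk_add_mk, smul_eq_mul, ← add_mul, hab, one_mul] at h
    exact h
  have hScl : ∀ n, IsClosed (S n) := fun n =>
    Metric.isClosed_closedBall.inter (hcl.preimage (by fun_prop))
  have hSmono : ∀ {n m : ℕ}, n ≤ m → S n ⊆ S m := fun {n m} hnm k hk =>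
    ⟨Metric.closedBall_subset_closedBall (Nat.cast_le.2 hnm) hk.1,
      hup _ _ _ hk.2 (Nat.cast_le.2 hnm)⟩
  have hSmem : ∀ {k r}, (k, r) ∈ E → ∃ n : ℕ, k ∈ S n := by
    intro k r hk
    obtain ⟨n, hn⟩ := exists_nat_ge (max ‖k‖ r)
    exact ⟨n, by simpa using (le_max_left _ _).trans hn, hup _ _ _ hk ((le_max_right _ _).trans hn)⟩
  set D : ℕ → Set V := fun n => {z | (z : H) ∈ T '' S n}
  have hDconv : ∀ n, Convex ℝ (D n) := fun n =>
    ((hSconv n).linear_image T.toLinearMap).linear_preimage V.subtype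
  have hDcl : ∀ n, IsClosed (D n) := fun n =>
    (isClosed_image_of_convex_of_bounded T (hScl n) (hSconv n) (R := n)
      fun x hx => by simpa using hx.1).preimage continuous_subtype_val
  have hDmono : ∀ {n m : ℕ}, n ≤ m → D n ⊆ D m := fun hnm z hz =>
    Set.image_mono (hSmono hnm) hz
  obtain ⟨n₀, hn₀⟩ : ∃ n₀, (0 : V) ∈ D n₀ := by
    obtain ⟨t, ht, k, r, hk, h0⟩ := hcone 0 V.zero_mem
    obtain ⟨n, hn⟩ := hSmem hk
    exact ⟨n, k, hn, by simpa [ht.ne'] using h0.symm⟩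
  have hcover : ⋃ n : ℕ, {z : V | ((n : ℝ) + 1)⁻¹ • z ∈ D n} = Set.univ := by
    refine Set.eq_univ_of_forall fun z => Set.mem_iUnion.2 ?_
    obtain ⟨t, ht, k, r, hk, hz⟩ := hcone z z.2
    obtain ⟨n₁, hn₁⟩ := hSmem hk
    obtain ⟨n₂, hn₂⟩ := exists_nat_ge t
    set n := max n₀ (max n₁ n₂)
    have htn : t ≤ (n : ℝ) + 1 := by
      have : (n₂ : ℝ) ≤ n := Nat.cast_le.2 ((le_max_right _ _).trans (le_max_right _ _))
      linarith
    have hz' : t⁻¹ • z ∈ D n :=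
      ⟨k, hSmono ((le_max_left _ _).trans (le_max_right _ _)) hn₁, by simp [hz, ht.ne']⟩
    refine ⟨n, ?_⟩
    have hpos : (0 : ℝ) < n + 1 := by positivity
    have h := (hDconv n).smul_mem_of_zero_mem (hDmono (le_max_left _ _) hn₀) hz'
      (t := ((n : ℝ) + 1)⁻¹ * t) ⟨by positivity, by
        rw [inv_mul_le_iff₀ hpos]; linarith⟩
    rwa [smul_smul, mul_assoc, mul_inv_cancel₀ ht.ne', mul_one] at h
  have : CompleteSpace V := hV.completeSpace_coe
  obtain ⟨n, c, hc⟩ := nonempty_interior_of_iUnion_of_closed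
    (fun n => (hDcl n).preimage (continuous_const_smul _)) hcover
  obtain ⟨r, hr, hball⟩ := Metric.mem_nhds_iff.1 (mem_interior_iff_mem_nhds.1 hc)
  obtain ⟨m, hm⟩ := Set.mem_iUnion.1 (hcover.symm ▸ Set.mem_univ (-c))
  set a : ℝ := ((n : ℝ) + 1)⁻¹
  set b : ℝ := ((m : ℝ) + 1)⁻¹
  have ha : 0 < a := by positivity
  have hb : 0 < b := by positivity
  -- The convex combination with weights `b / (a + b)` and `a / (a + b)` cancels the centre `c`,
  -- moving the ball to 0 with radius scaled by `q`.
  set q : ℝ := a * b / (a + b)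
  have hq : 0 < q := by positivity
  refine ⟨q * r, by positivity, (max n m : ℕ), fun z hz hzn => ?_⟩
  set w : V := q⁻¹ • ⟨z, hz⟩
  have hw : ‖w‖ < r := by
    rw [norm_smul, norm_inv, Real.norm_of_nonneg hq.le, inv_mul_lt_iff₀ hq]
    exact hzn
  have h₁ : a • (c + w) ∈ D (max n m) := hDmono (le_max_left _ _) (hball (by simpa using hw))
  have h₂ : b • (-c) ∈ D (max n m) := hDmono (le_max_right _ _) hm
  obtain ⟨k, hk, hkz⟩ := hDconv _ h₁ h₂ (a := b / (a + b)) (b := a / (a + b)) (by positivity)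
    (by positivity) (by field_simp; ring)
  refine ⟨k, hk.2, hkz.trans ?_⟩
  have e : (b / (a + b)) • a • (c + w) + (a / (a + b)) • b • (-c) = q • w := by
    have e₁ : b / (a + b) * a = q := by simp only [q]; ring
    have e₂ : a / (a + b) * b = q := by simp only [q]; ring
    rw [smul_smul, smul_smul, e₁, e₂, ← smul_add]
    congr 1
    abel
  rw [e]
  simp [w, hq.ne']

/-- A Hahn–Banach theorem for closed convex sets `E ⊆ K × ℝ` under the Attouch–Brezis
qualification condition. -/
theorem exists_inner_map_le_of_cone_eq {K H : Type*} [NormedAddCommGroup K]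
    [InnerProductSpace ℝ K] [CompleteSpace K] [NormedAddCommGroup H] [InnerProductSpace ℝ H]
    [CompleteSpace H] (T : K →L[ℝ] H) {E : Set (K × ℝ)} (hconv : Convex ℝ E) (hcl : IsClosed E)
    (hup : ∀ k r r', (k, r) ∈ E → r ≤ r' → (k, r') ∈ E) {V : Submodule ℝ H}
    (hV : IsClosed (V : Set H)) (hTV : ∀ k r, (k, r) ∈ E → T k ∈ V)
    (hcone : ∀ z ∈ V, ∃ t : ℝ, 0 < t ∧ ∃ k r, (k, r) ∈ E ∧ z = t • T k)
    (hnonneg : ∀ k r, (k, r) ∈ E → T k = 0 → 0 ≤ r) :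
    ∃ x : H, ∀ k r, (k, r) ∈ E → inner ℝ x (T k) ≤ r := by
  obtain ⟨δ, hδ, N, hN⟩ := exists_forall_norm_lt_exists_map_eq T hconv hcl hup hV hcone
  have : CompleteSpace V := hV.completeSpace_coe
  set A : Set (V × ℝ) := {p | ∃ k, (k, p.2) ∈ E ∧ T k = p.1}
  have hAconv : Convex ℝ A := by
    rintro ⟨z, r⟩ ⟨k, hk, hkz⟩ ⟨w, s⟩ ⟨l, hl, hlw⟩ a b ha hb hab
    exact ⟨a • k + b • l, hconv hk hl ha hb hab, by simp [hkz, hlw]⟩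
  have hint : ((0 : V), N + 1) ∈ interior A := by
    rw [mem_interior_iff_mem_nhds]
    filter_upwards [prod_mem_nhds (Metric.ball_mem_nhds (0 : V) hδ) (lt_mem_nhds (lt_add_one N))]
      with ⟨z, r⟩ h
    obtain ⟨k, hk, hkz⟩ := hN z z.2 (by simpa using h.1)
    exact ⟨k, hup _ _ _ hk (le_of_lt h.2), hkz⟩
  have hzero : ((0 : V), (0 : ℝ)) ∉ interior A := by
    rw [mem_interior_iff_mem_nhds]
    intro h
    have hcont : Filter.Tendsto (fun r : ℝ => ((0 : V), r)) (nhds 0) (nhds (0, 0)) :=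
      Continuous.tendsto (by fun_prop) 0
    obtain ⟨r, hr, k, hk, hk0⟩ := ((hcont.eventually h).filter_mono nhdsWithin_le_nhds |>.and
      (self_mem_nhdsWithin : Set.Iio (0 : ℝ) ∈ nhdsWithin 0 (Set.Iio 0))).exists.imp
        fun r h => And.intro h.2 h.1
    exact absurd (hnonneg k r hk (by simpa using hk0)) (not_le.2 hr)
  obtain ⟨φ, hφ⟩ := geometric_hahn_banach_open_point hAconv.interior isOpen_interior hzero
  have hφA : ∀ p ∈ A, φ p ≤ 0 := by
    intro p hp
    have hp' : p ∈ closure (interior A) := by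
      rw [hAconv.closure_interior_eq_closure_of_nonempty_interior ⟨_, hint⟩]
      exact subset_closure hp
    refine closure_minimal (fun q hq => ?_) (isClosed_le φ.continuous continuous_const) hp'
    exact (hφ q hq).le.trans_eq (map_zero φ)
  set α := φ (0, 1)
  have hsplit : ∀ z r, φ (z, r) = φ (z, 0) + r * α := by
    intro z r
    rw [← smul_eq_mul, ← map_smul, ← map_add]
    simp
  -- The separating hyperplane is not vertical, because an interior point of `A` lies above 0.
  have hα : α < 0 := by
    obtain ⟨k, hk, hk0⟩ := hN 0 V.zero_mem (by simpa using hδ)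
    have hN0 := hnonneg k N hk hk0
    have h := hφ _ hint
    rw [hsplit, show ((0 : V), (0 : ℝ)) = 0 from rfl, map_zero, zero_add] at h
    by_contra! hα
    nlinarith
  set ψ : StrongDual ℝ V := (-α)⁻¹ • φ.comp (ContinuousLinearMap.inl ℝ V ℝ)
  refine ⟨((InnerProductSpace.toDual ℝ V).symm ψ : V), fun k r hk => ?_⟩
  have h := hφA (⟨T k, hTV k r hk⟩, r) ⟨k, hk, rfl⟩
  have e : inner ℝ (((InnerProductSpace.toDual ℝ V).symm ψ : V) : H) (T k)
      = ψ ⟨T k, hTV k r hk⟩ := by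
    rw [← InnerProductSpace.toDual_symm_apply]
    rfl
  rw [e]
  rw [hsplit] at h
  simp only [ψ, smul_apply, smul_eq_mul]
  change (-α)⁻¹ * φ (⟨T k, hTV k r hk⟩, 0) ≤ r
  rw [inv_mul_le_iff₀ (by linarith)]
  linarith

/-! ### Conjugates and Fenchel–Moreau -/

open ContinuousLinearMap (adjoint)

section Functions

variable {H G : Type*}

theorem exists_le_coe_of_mem_dom {f : H → EReal} {x : H} (h : x ∈ dom f) : ∃ r : ℝ, f x ≤ r := by
  obtain ⟨r, hr, -⟩ := EReal.lt_iff_exists_real_btwn.1 (show f x < ⊤ from h)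
  exact ⟨r, hr.le⟩

theorem mem_dom_of_le_coe {f : H → EReal} {x : H} {r : ℝ} (h : f x ≤ r) : x ∈ dom f :=
  h.trans_lt (EReal.coe_lt_top r)

theorem infPostcomp_le {f : H → EReal} {L : H → G} (x : H) : infPostcomp L f (L x) ≤ f x :=
  sInf_le ⟨x, rfl, rfl⟩

end Functions

variable {H : Type*} [NormedAddCommGroup H] [InnerProductSpace ℝ H]
variable {G : Type*} [NormedAddCommGroup G] [InnerProductSpace ℝ G]

/-- Quantifying over the epigraph of `f` keeps later arguments in real arithmetic. -/
theorem conj_le_coe_iff {f : H → EReal} {u : H} {ρ : ℝ} :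
    conj f u ≤ ρ ↔ ∀ x, ∀ r : ℝ, f x ≤ r → inner ℝ x u - ρ ≤ r := by
  rw [conj, iSup_le_iff]
  refine forall_congr' fun x => ?_
  induction f x with
  | bot =>
    rw [EReal.coe_sub_bot]
    refine iff_of_false (by simp) fun h => ?_
    have := h (inner ℝ x u - ρ - 1) bot_le
    linarith
  | coe a =>
    rw [← EReal.coe_sub, EReal.coe_le_coe_iff]
    refine ⟨fun h r hr => ?_, fun h => ?_⟩
    · have := EReal.coe_le_coe_iff.1 hr
      linarith
    · have := h a le_rfl
      linarith
  | top => simp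

/-- The Fenchel–Moreau theorem, for functions whose conjugate is finite somewhere. -/
theorem le_coe_of_forall_conj_le [CompleteSpace H] {f : H → EReal} (hf : f ∈ Gamma0 H)
    (hdom : (dom (conj f)).Nonempty) {x : H} {s : ℝ}
    (h : ∀ u, ∀ ρ : ℝ, conj f u ≤ ρ → inner ℝ x u - ρ ≤ s) : f x ≤ s := by
  obtain ⟨-, ⟨y₀, hy₀⟩, hlsc, hconv⟩ := hf
  obtain ⟨r₀, hr₀⟩ := exists_le_coe_of_mem_dom hy₀
  obtain ⟨u₀, hu₀⟩ := hdom
  obtain ⟨ρ₀, hρ₀⟩ := exists_le_coe_of_mem_dom hu₀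
  have hcl : IsClosed {p : H × ℝ | f p.1 ≤ (p.2 : EReal)} :=
    (lowerSemicontinuous_iff_isClosed_epigraph.1 hlsc).preimage
      (f := fun p : H × ℝ => (p.1, (p.2 : EReal)))
      (continuous_fst.prodMk (continuous_coe_real_ereal.comp continuous_snd))
  by_contra hx
  obtain ⟨φ, c, hφ, hc⟩ := geometric_hahn_banach_closed_point hconv hcl (x := (x, s)) hx
  set β := φ (0, 1)
  set a := (InnerProductSpace.toDual ℝ H).symm (φ.comp (ContinuousLinearMap.inl ℝ H ℝ))
  have hsplit : ∀ y r, φ (y, r) = inner ℝ y a + r * β := by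
    intro y r
    have : inner ℝ a y = φ (y, 0) := InnerProductSpace.toDual_symm_apply
    rw [real_inner_comm, this, ← smul_eq_mul, ← map_smul, ← map_add]
    simp
  have hepi : ∀ y, ∀ r : ℝ, f y ≤ r → inner ℝ y a + r * β < c := fun y r hr =>
    hsplit y r ▸ hφ (y, r) hr
  rw [hsplit] at hc
  -- A negative slope gives an affine minorant exceeding `s` at `x`. For a vertical hyperplane, a
  -- large multiple is added to the minorant from `u₀`. A positive slope contradicts upward
  -- unboundedness of the epigraph.
  rcases lt_trichotomy β 0 with hβ | hβ | hβ
  · have hβ' : 0 < -β := by linarith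
    have hconj : conj f ((-β)⁻¹ • a) ≤ ((-β)⁻¹ * c : ℝ) := by
      refine conj_le_coe_iff.2 fun y r hr => ?_
      rw [inner_smul_right, ← mul_sub, inv_mul_le_iff₀ hβ']
      linarith [hepi y r hr]
    have := h _ _ hconj
    rw [inner_smul_right, ← mul_sub, inv_mul_le_iff₀ hβ'] at this
    linarith
  · rw [hβ, mul_zero, add_zero] at hc
    have hpos : 0 < inner ℝ x a - c := by linarith
    have hu := h u₀ ρ₀ hρ₀
    set t := (s - inner ℝ x u₀ + ρ₀ + 1) / (inner ℝ x a - c)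
    have ht : 0 ≤ t := div_nonneg (by linarith) hpos.le
    have hconj : conj f (u₀ + t • a) ≤ (ρ₀ + t * c : ℝ) := by
      refine conj_le_coe_iff.2 fun y r hr => ?_
      have h₁ := conj_le_coe_iff.1 hρ₀ y r hr
      have h₂ := hepi y r hr
      rw [hβ, mul_zero, add_zero] at h₂
      have := mul_le_mul_of_nonneg_left h₂.le ht
      rw [inner_add_right, inner_smul_right]
      linarith
    have h₁ := h _ _ hconj
    rw [inner_add_right, inner_smul_right] at h₁
    have h₂ : t * (inner ℝ x a - c) = s - inner ℝ x u₀ + ρ₀ + 1 := div_mul_cancel₀ _ hpos.ne'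
    linarith
  · set t := |c - inner ℝ y₀ a - r₀ * β| / β
    have ht : 0 ≤ t := by positivity
    have h₁ := hepi y₀ (r₀ + t) (hr₀.trans (EReal.coe_le_coe_iff.2 (by linarith)))
    have h₂ : t * β = |c - inner ℝ y₀ a - r₀ * β| := div_mul_cancel₀ _ hβ.ne'
    have h₃ := le_abs_self (c - inner ℝ y₀ a - r₀ * β)
    linarith

theorem mem_dom_of_mem_subdiff {F : H → EReal} (hF : (dom F).Nonempty) {x u : H}
    (h : u ∈ subdiff F x) : x ∈ dom F := by
  obtain ⟨z, hz⟩ := hF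
  refine (lt_top_iff_ne_top (a := F x)).2 fun hx => ?_
  have h₁ := (h z).trans_lt hz
  rw [hx, EReal.coe_add_top] at h₁
  exact lt_irrefl _ h₁

/-! ### Exact duality and its consequences -/

section Duality

variable [CompleteSpace H] [CompleteSpace G] {f : H → EReal} {L : H →L[ℝ] G}

/-- Attouch–Brezis duality: the conjugate of `f* ∘ L*` is the infimal postcomposition of `f` by
`L`, and the infimum is attained. -/
theorem exists_map_eq_le_coe (hf : f ∈ Gamma0 H)
    (hL : (0 : H) ∈ sri (Set.range (adjoint L) - dom (conj f))) {y : G} {s : ℝ}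
    (h : ∀ v, ∀ ρ : ℝ, conj f (adjoint L v) ≤ ρ → inner ℝ y v - ρ ≤ s) :
    ∃ x, L x = y ∧ f x ≤ s := by
  obtain ⟨⟨-, -, u₀, hu₀, -⟩, V, hV, hcone⟩ := hL
  simp only [neg_zero, zero_add, Set.image_id'] at hcone
  -- The `WithLp 2` norm makes the product a Hilbert space.
  set T : WithLp 2 (H × G) →L[ℝ] H :=
    (adjoint L).comp (WithLp.sndL 2 ℝ H G) - WithLp.fstL 2 ℝ H G
  have hT : ∀ k, T k = adjoint L k.snd - k.fst := fun k => rfl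
  set E : Set (WithLp 2 (H × G) × ℝ) :=
    {p | conj f p.1.fst ≤ (p.2 + inner ℝ y p.1.snd - s : ℝ)}
  have hE : ∀ {k r}, (k, r) ∈ E ↔ conj f k.fst ≤ (r + inner ℝ y k.snd - s : ℝ) := Iff.rfl
  have hconv : Convex ℝ E := by
    rintro ⟨k, p⟩ hk ⟨l, q⟩ hl a b ha hb hab
    refine hE.2 (conj_le_coe_iff.2 fun x r hr => ?_)
    have h₁ := mul_le_mul_of_nonneg_left (conj_le_coe_iff.1 (hE.1 hk) x r hr) ha
    have h₂ := mul_le_mul_of_nonneg_left (conj_le_coe_iff.1 (hE.1 hl) x r hr) hb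
    simp only [Prod.smul_fst, Prod.smul_snd, WithLp.add_fst,
      WithLp.add_snd, WithLp.smul_fst, WithLp.smul_snd, inner_add_right, inner_smul_right,
      smul_eq_mul]
    linear_combination h₁ + h₂ + (r - s) * hab
  have hcl : IsClosed E := by
    have : E = ⋂ (x) (r : ℝ) (_ : f x ≤ r), {p : WithLp 2 (H × G) × ℝ |
        inner ℝ x (WithLp.fstL 2 ℝ H G p.1) -
          (p.2 + inner ℝ y (WithLp.sndL 2 ℝ H G p.1) - s) ≤ r} := by
      ext ⟨k, p⟩
      simp only [hE, conj_le_coe_iff, Set.mem_iInter, Set.mem_ofPred_eq]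
      rfl
    rw [this]
    exact isClosed_iInter fun x => isClosed_iInter fun r => isClosed_iInter fun _ =>
      isClosed_le (by fun_prop) continuous_const
  obtain ⟨x, hx⟩ := exists_inner_map_le_of_cone_eq T hconv hcl
    (fun k r r' hk hr => (hE.1 hk).trans (EReal.coe_le_coe_iff.2 (by linarith))) hV
    (fun k r hk => by
      rw [← SetLike.mem_coe, ← hcone]
      exact ⟨1, one_pos, _, Set.sub_mem_sub ⟨k.snd, rfl⟩ (mem_dom_of_le_coe (hE.1 hk)),
        (one_smul ℝ _).symm⟩)
    (fun z hz => by
      rw [← SetLike.mem_coe, ← hcone] at hz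
      obtain ⟨t, ht, _, ⟨_, ⟨v, rfl⟩, u, hu, rfl⟩, rfl⟩ := hz
      obtain ⟨ρ, hρ⟩ := exists_le_coe_of_mem_dom hu
      refine ⟨t, ht, WithLp.toLp 2 (u, v), ρ - inner ℝ y v + s, hE.2 ?_, rfl⟩
      refine hρ.trans (EReal.coe_le_coe_iff.2 ?_)
      change ρ ≤ ρ - inner ℝ y v + s + inner ℝ y v - s
      linarith)
    (fun k r hk hk0 => by
      rw [hT, sub_eq_zero] at hk0
      have := h k.snd _ (hk0 ▸ hE.1 hk)
      linarith)
  have hx' : ∀ u v, ∀ ρ : ℝ, conj f u ≤ ρ →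
      inner ℝ (L x + y) v - inner ℝ x u ≤ ρ + s := by
    intro u v ρ hρ
    have h₁ := hx (WithLp.toLp 2 (u, v)) (ρ - inner ℝ y v + s) (hE.2 (by
      refine hρ.trans (EReal.coe_le_coe_iff.2 ?_)
      change ρ ≤ ρ - inner ℝ y v + s + inner ℝ y v - s
      linarith))
    rw [hT] at h₁
    change inner ℝ x (adjoint L v - u) ≤ _ at h₁
    rw [inner_sub_right, ContinuousLinearMap.adjoint_inner_right] at h₁
    rw [inner_add_left]
    linarith
  -- A linear function of `v` bounded above vanishes; the multiple of `L x + y` chosen below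
  -- overshoots the bound by 1.
  have hLx : L x + y = 0 := by
    obtain ⟨ρ₀, hρ₀⟩ := exists_le_coe_of_mem_dom hu₀
    by_contra hne
    have hpos : 0 < inner ℝ (L x + y) (L x + y) := real_inner_self_pos.2 hne
    have h₁ := hx' u₀ (((ρ₀ + s + inner ℝ x u₀ + 1) / inner ℝ (L x + y) (L x + y)) • (L x + y))
      ρ₀ hρ₀
    rw [inner_smul_right, div_mul_cancel₀ _ hpos.ne'] at h₁
    linarith
  refine ⟨-x, by rw [map_neg, ← eq_neg_of_add_eq_zero_right hLx],
    le_coe_of_forall_conj_le hf ⟨u₀, hu₀⟩ fun u ρ hρ => ?_⟩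
  have h₁ := hx' u 0 ρ hρ
  rw [inner_zero_right] at h₁
  rw [inner_neg_left]
  linarith

/-- One direction is Fenchel–Young, with `ε` for near-minimisers; the other is exact duality. The
right side is a family of affine inequalities in `(y, s)`, whence lower semicontinuity and
convexity. -/
theorem infPostcomp_le_coe_iff (hf : f ∈ Gamma0 H)
    (hL : (0 : H) ∈ sri (Set.range (adjoint L) - dom (conj f))) {y : G} {s : ℝ} :
    infPostcomp L f y ≤ s ↔
      ∀ v, ∀ ρ : ℝ, conj f (adjoint L v) ≤ ρ → inner ℝ y v - ρ ≤ s := by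
  refine ⟨fun h v ρ hρ => ?_, fun h => ?_⟩
  · refine le_of_forall_pos_le_add fun ε hε => ?_
    have hlt : infPostcomp L f y < (s + ε : ℝ) :=
      h.trans_lt (EReal.coe_lt_coe_iff.2 (by linarith))
    obtain ⟨_, ⟨x, rfl, rfl⟩, hx⟩ := sInf_lt_iff.1 hlt
    have := conj_le_coe_iff.1 hρ x (s + ε) hx.le
    rwa [ContinuousLinearMap.adjoint_inner_right] at this
  · obtain ⟨x, rfl, hx⟩ := exists_map_eq_le_coe hf hL h
    exact (infPostcomp_le x).trans hx

theorem infPostcomp_mem_Gamma0 (hf : f ∈ Gamma0 H)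
    (hL : (0 : H) ∈ sri (Set.range (adjoint L) - dom (conj f))) :
    infPostcomp L f ∈ Gamma0 G := by
  have hbot : ∀ y, infPostcomp L f y ≠ ⊥ := by
    intro y hy
    -- Some `L*v` lies in `dom f*`, which yields an affine minorant.
    obtain ⟨-, ⟨v, rfl⟩, u, hu, huv⟩ := hL.1
    rw [← sub_eq_zero.1 huv] at hu
    obtain ⟨ρ, hρ⟩ := exists_le_coe_of_mem_dom hu
    have := (infPostcomp_le_coe_iff hf hL (y := y) (s := inner ℝ y v - ρ - 1)).1
      (hy ▸ bot_le) v ρ hρ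
    linarith
  refine ⟨hbot, ?_, ?_, ?_⟩
  · obtain ⟨x, hx⟩ := hf.2.1
    exact ⟨L x, (infPostcomp_le x).trans_lt hx⟩
  · refine lowerSemicontinuous_iff_isClosed_preimage.2 fun s => ?_
    induction s with
    | bot =>
      convert isClosed_empty
      ext y
      simpa using hbot y
    | coe s =>
      have : infPostcomp L f ⁻¹' Set.Iic (s : EReal) =
          ⋂ (v) (ρ : ℝ) (_ : conj f (adjoint L v) ≤ ρ), {y | inner ℝ y v - ρ ≤ s} := by
        ext y
        simp only [Set.mem_preimage, Set.mem_Iic, infPostcomp_le_coe_iff hf hL, Set.mem_iInter,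
          Set.mem_ofPred_eq]
      rw [this]
      exact isClosed_iInter fun v => isClosed_iInter fun ρ => isClosed_iInter fun _ =>
        isClosed_le (by fun_prop) continuous_const
    | top => simp
  · rintro ⟨y, p⟩ hy ⟨z, q⟩ hz a b ha hb hab
    refine (infPostcomp_le_coe_iff hf hL).2 fun v ρ hρ => ?_
    have h₁ := mul_le_mul_of_nonneg_left ((infPostcomp_le_coe_iff hf hL).1 hy v ρ hρ) ha
    have h₂ := mul_le_mul_of_nonneg_left ((infPostcomp_le_coe_iff hf hL).1 hz v ρ hρ) hb
    simp only [Prod.fst_add, Prod.snd_add, Prod.smul_fst, Prod.smul_snd, inner_add_left,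
      real_inner_smul_left, smul_eq_mul]
    linear_combination h₁ + h₂ + ρ * hab

/-- The infimum defining the infimal postcomposition is attained at points of its domain. -/
theorem exists_map_eq_eq_infPostcomp (hf : f ∈ Gamma0 H)
    (hL : (0 : H) ∈ sri (Set.range (adjoint L) - dom (conj f))) {y : G}
    (hy : y ∈ dom (infPostcomp L f)) : ∃ x, L x = y ∧ f x = infPostcomp L f y := by
  have hs : ((infPostcomp L f y).toReal : EReal) = infPostcomp L f y :=
    EReal.coe_toReal hy.ne ((infPostcomp_mem_Gamma0 hf hL).1 y)
  obtain ⟨x, rfl, hx⟩ :=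
    exists_map_eq_le_coe hf hL ((infPostcomp_le_coe_iff hf hL).1 hs.ge)
  exact ⟨x, rfl, (hx.trans_eq hs).antisymm (infPostcomp_le x)⟩

end Duality

end ParallelComposition

end

theorem corollary2p6
    {H : Type*} [NormedAddCommGroup H] [InnerProductSpace ℝ H] [CompleteSpace H]
    {G : Type*} [NormedAddCommGroup G] [InnerProductSpace ℝ G] [CompleteSpace G]
    (f : H → EReal) (hf : f ∈ ParallelComposition.Gamma0 H) (L : H →L[ℝ] G)
    (hL : (0 : H) ∈ ParallelComposition.sri
      (Set.range (ContinuousLinearMap.adjoint L) -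
        ParallelComposition.dom (ParallelComposition.conj f))) :
    ParallelComposition.infPostcomp L f ∈ ParallelComposition.Gamma0 G ∧
      ParallelComposition.subdiff (ParallelComposition.infPostcomp L f) =
        ParallelComposition.parComp L (ParallelComposition.subdiff f) := by
  have hΓ := ParallelComposition.infPostcomp_mem_Gamma0 hf hL
  refine ⟨hΓ, funext fun y => Set.ext fun v => ⟨fun hv => ?_, ?_⟩⟩
  -- Attainment is essential here: the minimiser `x` over `y` satisfies `L*v ∈ ∂f(x)`.
  · obtain ⟨x, rfl, hx⟩ :=
      ParallelComposition.exists_map_eq_eq_infPostcomp hf hL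
        (ParallelComposition.mem_dom_of_mem_subdiff hΓ.2.1 hv)
    refine ⟨x, fun z => ?_, rfl⟩
    rw [ContinuousLinearMap.adjoint_inner_right, map_sub, hx]
    exact (hv (L z)).trans (ParallelComposition.infPostcomp_le z)
  -- Here `(L ▷ f)(Lx) ≤ f(x)` suffices; the inequality is checked on each point of the fibre over
  -- `w`.
  · rintro ⟨x, hx, rfl⟩ w
    refine le_sInf ?_
    rintro _ ⟨z, rfl, rfl⟩
    have h := hx z
    rw [ContinuousLinearMap.adjoint_inner_right, map_sub] at h
    exact (add_le_add_right (ParallelComposition.infPostcomp_le x) _).trans h
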